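/- Let $W\in\mathbb{R}^{n\times n}$ be a row-stochastic matrix whose directed graph on $\mathcal V=[n]$ (with a link from $i$ to $j$ if and only if $W_{ji}>0$) is strongly connected, let $\Theta=\mathrm{diag}(\theta_1,\dots,\theta_n)$ with $\theta\le\theta_i\le 1$ for all $i$, where $\theta>0$, let $\omega\in(0,1)$, and let $\mathcal S\subset\mathcal V$ contain at least one agent $i$ with $\theta_i<1$. Let $\mathbf e_{\mathcal S}:=\sum_{j\in\mathcal S}\mathbf e_j$ and $H(\mathcal S):=\bigl(I-\omega\sum_{j\in\mathcal S}\mathbf e_j\mathbf e_j^\top\bigr)(I-\Theta)W$. Consider the Friedkin–Johnsen model $\bar{\mathbf x}(t+1)=(I-\bar\Theta)\bar W\bar{\mathbf x}(t)+\bar\Theta\bar{\mathbf x}(0)$ extended by a fully stubborn influencer $0$ linked to the agents in $\mathcal S$ with weight $\omega$, i.e. $$\bar W=\begin{pmatrix}1&\mathbf 0\\ \omega\,\mathbf e_{\mathcal S}&\bigl(I-\omega\sum_{j\in\mathcal S}\mathbf e_j\mathbf e_j^\top\bigr)W\end{pmatrix},\qquad \bar\Theta=\mathrm{diag}(1,\theta_1,\dots,\theta_n),\qquad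 \bar P=(I-(I-\bar\Theta)\bar W)^{-1}\bar\Theta .$$ Let $\mathrm{sp}_0(\mathcal S):=\frac1n\sum_{i=1}^n\bar P_{i0}$ be the social power of the influencer over the $n$ regular agents, and let $$\mathrm{sp}_0^\ell(\mathcal S):=\frac1n\mathbf 1^\top\sum_{k=0}^{\ell}H(\mathcal S)^k(I-\Theta)\,\omega\,\mathbf e_{\mathcal S}$$ be its truncation. Consider the Markov chain with absorbing states $0$ and $1',\dots,n'$, transient states $1,\dots,n$, and transition probabilities $T_{i0}=\omega(1-\theta_i)$ for $i\in\mathcal S$, $T_{i0}=0$ for $i\in\mathcal V\setminus\mathcal S$, $T_{ij}=H(\mathcal S)_{ij}$ and $T_{ii'}=\theta_i$ for $i,j\in\mathcal V$. Generate $r$ independent random walks $Y_0,Y_1,\dots,Y_{\ell+1}$ of this chain ($\ell$ steps, followed by a last step, which may be absorbing), with $Y_0$ uniformly distributed over $[n]$, and let $\mathrm{sp}_0^{\mathrm{apx}}(\mathcal S)$ be the fraction of the $r$ walks that are absorbed by the state $0$. Let $\epsilon,\delta,\sigma\in(0,1)$ and let $r,\ell$ be nonnegative integers with $$r\ \ge\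 \frac{3}{\sigma^2\epsilon^2\,\mathrm{sp}_0^\ell(\mathcal S)}\log\frac2\delta,\qquad \ell\ \ge\ \frac{\log\bigl(\theta(1-\sigma)\epsilon\,\mathrm{sp}_0^\ell(\mathcal S)\bigr)-\log\omega}{\log(1-\theta)}-2 .$$ Then $$\mathbb P\bigl(|\mathrm{sp}_0^{\mathrm{apx}}(\mathcal S)-\mathrm{sp}_0(\mathcal S)|<\epsilon\,\mathrm{sp}_0^\ell(\mathcal S)\bigr)\ \ge\ 1-\delta .$$ -/

import Mathlib

open MeasureTheory ProbabilityTheory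

namespace FJ

noncomputable section

variable {n : ℕ}

/-- The weighted graph of `W` has a link from `i` to `j` iff `W j i > 0`; it is strongly connected
if every node is joined to every node by a directed path. -/
def StronglyConnected (W : Matrix (Fin n) (Fin n) ℝ) : Prop :=
  ∀ i j : Fin n, Relation.ReflTransGen (fun a b => 0 < W b a) i j

/-- The vector `∑ j ∈ S, e_j`. -/
def ind (S : Finset (Fin n)) (i : Fin n) : ℝ := if i ∈ S then 1 else 0

/-- Weight matrix of the network extended by the influencer `none`, who is linked to the agents
in `S` with weight `ω`. -/
def augWeight (W : Matrix (Fin n) (Fin n) ℝ) (ω : ℝ) (S : Finset (Fin n)) :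
    Matrix (Option (Fin n)) (Option (Fin n)) ℝ
  | none, none => 1
  | none, some _ => 0
  | some i, none => ω * ind S i
  | some i, some j => (1 - ω * ind S i) * W i j

/-- Stubbornness in the extended network: the influencer is fully stubborn. -/
def augStub (stub : Fin n → ℝ) : Option (Fin n) → ℝ
  | none => 1
  | some i => stub i

/-- The solution matrix `(I - (I - Θ)W)⁻¹ Θ` of the Friedkin–Johnsen model
`x(t+1) = (I - Θ) W x(t) + Θ x(0)`; it maps `x(0)` to `x(∞)`. -/
def solution {ι : Type*} [Fintype ι] [DecidableEq ι] (W : Matrix ι ι ℝ) (stub : ι → ℝ) :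
    Matrix ι ι ℝ :=
  (1 - (1 - Matrix.diagonal stub) * W)⁻¹ * Matrix.diagonal stub

/-- Social power of the influencer over the `n` regular agents: the average over the agents of the
weight of the influencer's initial opinion in their final opinions. -/
def sp₀ (W : Matrix (Fin n) (Fin n) ℝ) (stub : Fin n → ℝ) (ω : ℝ) (S : Finset (Fin n)) : ℝ :=
  (1 / (n : ℝ)) * ∑ i : Fin n, solution (augWeight W ω S) (augStub stub) (some i) none

/-- `H(S) = (I - ω ∑ j ∈ S, e_j e_jᵀ) (I - Θ) W`. -/
def H (W : Matrix (Fin n) (Fin n) ℝ) (stub : Fin n → ℝ) (ω : ℝ) (S : Finset (Fin n)) :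
    Matrix (Fin n) (Fin n) ℝ :=
  (1 - ω • Matrix.diagonal (ind S)) * (1 - Matrix.diagonal stub) * W

/-- Truncated social power
`(1/n) 𝟏ᵀ (∑ k = 0, …, ℓ, H(S)ᵏ) (I - Θ) ω ∑ j ∈ S, e_j`. -/
def spTrunc (W : Matrix (Fin n) (Fin n) ℝ) (stub : Fin n → ℝ) (ω : ℝ) (S : Finset (Fin n))
    (ℓ : ℕ) : ℝ :=
  (1 / (n : ℝ)) * ∑ i : Fin n,
    ((∑ k ∈ Finset.range (ℓ + 1), H W stub ω S ^ k).mulVec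
      ((1 - Matrix.diagonal stub).mulVec (ω • ind S))) i

/-- States of the augmented Markov chain: the absorbing state of the influencer, the transient
states `i`, and the absorbing states `i'`. -/
inductive State (n : ℕ) : Type
  | influencer : State n
  | agent (i : Fin n) : State n
  | anchor (i : Fin n) : State n
  deriving DecidableEq, Fintype

instance : MeasurableSpace (State n) := ⊤

instance : DiscreteMeasurableSpace (State n) := ⟨fun _ => trivial⟩

/-- Transition matrix of the augmented Markov chain. -/
def trans (W : Matrix (Fin n) (Fin n) ℝ) (stub : Fin n → ℝ) (ω : ℝ) (S : Finset (Fin n)) :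
    Matrix (State n) (State n) ℝ
  | .influencer, .influencer => 1
  | .agent i, .influencer => ω * (1 - stub i) * ind S i
  | .agent i, .agent j => H W stub ω S i j
  | .agent i, .anchor j => if i = j then stub i else 0
  | .anchor i, .anchor j => if i = j then 1 else 0
  | _, _ => 0

/-- The uniform distribution over the transient states. -/
def start : State n → ℝ
  | .agent _ => 1 / (n : ℝ)
  | _ => 0

/-- `Y` is a random walk `Y 0, …, Y m` of `m` steps of the augmented Markov chain whose starting
state is uniform over the transient states: its law gives each trajectory `y` the mass
`start (y 0) * T (y 0) (y 1) * ⋯ * T (y (m-1)) (y m)`. -/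
structure IsWalk {Ω : Type*} [MeasurableSpace Ω] (μ : Measure Ω)
    (W : Matrix (Fin n) (Fin n) ℝ) (stub : Fin n → ℝ) (ω : ℝ) (S : Finset (Fin n)) {m : ℕ}
    (Y : Ω → Fin (m + 1) → State n) : Prop where
  measurable : Measurable Y
  law : ∀ y : Fin (m + 1) → State n,
    μ.real {x | Y x = y} =
      start (y 0) * ∏ t : Fin m, trans W stub ω S (y t.castSucc) (y t.succ)

/-- Output of the Monte Carlo algorithm on the walks `w 1, …, w r`: the fraction of them that is
absorbed by the influencer's state. -/
def spApx {r m : ℕ} (w : Fin r → Fin (m + 1) → State n) : ℝ :=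
  ((Finset.univ.filter fun k => ∃ t, w k t = State.influencer).card : ℝ) / r

end

end FJ

/-!
A walk that visits the influencer's absorbing state stays there, so it is absorbed with
probability `start ᵥ* T ^ (ℓ + 1)` evaluated at the influencer, which is the truncated social power
`spTrunc`; the multiplicative Chernoff bound with relative error `σ ε` then controls
`|spApx - spTrunc|` up to probability `δ`. The exact social power averages the fixed point of
`v ↦ H v + (I - Θ) ω e_S`, a contraction of rate `1 - θ` in the sup norm, and `spTrunc` averages its
partial Neumann sum, so the truncation costs at most `ω (1 - θ) ^ (ℓ + 2) / θ ≤ (1 - σ) ε spTrunc`.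
-/

namespace FJ

open Matrix

section Chernoff

variable {Ω : Type*} [MeasurableSpace Ω] {μ : Measure Ω}

lemma exp_mul_le_one_add_mul {x : ℝ} (hx : x ∈ Set.Icc (0 : ℝ) 1) (t : ℝ) :
    Real.exp (t * x) ≤ 1 + (Real.exp t - 1) * x := by
  have h := convexOn_exp.2 (Set.mem_univ 0) (Set.mem_univ t) (sub_nonneg.2 hx.2) hx.1
    (sub_add_cancel 1 x)
  simp only [smul_eq_mul, mul_zero, zero_add, Real.exp_zero, mul_one] at h
  rw [mul_comm t]
  linarith

lemma mgf_le_exp_mul_integral [IsProbabilityMeasure μ] {X : Ω → ℝ} (hX : AEMeasurable X μ)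
    (h01 : ∀ᵐ x ∂μ, X x ∈ Set.Icc (0 : ℝ) 1) (t : ℝ) :
    mgf X μ t ≤ Real.exp ((Real.exp t - 1) * μ[X]) := by
  have hint : Integrable X μ := Integrable.of_mem_Icc 0 1 hX h01
  calc mgf X μ t ≤ ∫ x, (1 + (Real.exp t - 1) * X x) ∂μ := by
        refine integral_mono_ae (integrable_exp_mul_of_mem_Icc hX h01)
          ((integrable_const 1).add (hint.const_mul _)) ?_
        filter_upwards [h01] with x hx using exp_mul_le_one_add_mul hx t
    _ = (Real.exp t - 1) * μ[X] + 1 := by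
        rw [integral_add (integrable_const _) (hint.const_mul _), integral_const_mul]
        simp [add_comm]
    _ ≤ _ := Real.add_one_le_exp _

variable {ι : Type*} [Fintype ι] {X : ι → Ω → ℝ}

lemma mgf_sum_le_exp_mul_sum_integral (hX : ∀ k, AEMeasurable (X k) μ)
    (h01 : ∀ k, ∀ᵐ x ∂μ, X k x ∈ Set.Icc (0 : ℝ) 1) (hind : iIndepFun X μ) (t : ℝ) :
    mgf (∑ k, X k) μ t ≤ Real.exp ((Real.exp t - 1) * ∑ k, μ[X k]) := by
  have := hind.isProbabilityMeasure
  rw [hind.mgf_sum₀ hX, Finset.mul_sum, Real.exp_sum]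
  exact Finset.prod_le_prod (fun _ _ => mgf_nonneg) fun k _ =>
    mgf_le_exp_mul_integral (hX k) (h01 k) t

lemma integrable_exp_mul_sum_of_mem_Icc [IsFiniteMeasure μ] (hX : ∀ k, AEMeasurable (X k) μ)
    (h01 : ∀ k, ∀ᵐ x ∂μ, X k x ∈ Set.Icc (0 : ℝ) 1) (t : ℝ) :
    Integrable (fun x => Real.exp (t * (∑ k, X k) x)) μ := by
  refine integrable_exp_mul_of_mem_Icc (a := 0) (b := Fintype.card ι)
    (Finset.aemeasurable_sum _ fun k _ => hX k) ?_
  filter_upwards [ae_all_iff.2 h01] with x hx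
  rw [Finset.sum_apply]
  refine ⟨Finset.sum_nonneg fun k _ => (hx k).1, ?_⟩
  simpa using Finset.sum_le_card_nsmul Finset.univ (X · x) 1 fun k _ => (hx k).2

lemma sub_mul_log_one_add_le {η : ℝ} (h0 : 0 ≤ η) (h1 : η ≤ 1) :
    η - (1 + η) * Real.log (1 + η) ≤ -(η ^ 2 / 3) := by
  have hlog := mul_le_mul_of_nonneg_left (Real.le_log_one_add_of_nonneg h0)
    (by linarith : 0 ≤ 1 + η)
  have hfrac : η + η ^ 2 / 3 ≤ (1 + η) * (2 * η / (η + 2)) := by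
    rw [mul_div_assoc', le_div_iff₀ (by linarith)]
    nlinarith [mul_nonneg (sq_nonneg η) (sub_nonneg.2 h1)]
  linarith

lemma exp_neg_le_quadratic {η : ℝ} (h0 : 0 ≤ η) : Real.exp (-η) ≤ 1 - η + η ^ 2 / 2 := by
  rw [Real.exp_neg]
  refine (inv_anti₀ (by positivity) (Real.quadratic_le_exp_of_nonneg h0)).trans ?_
  rw [inv_le_iff_one_le_mul₀ (by positivity)]
  nlinarith [sq_nonneg (η ^ 2)]

lemma sum_integral_nonneg (h01 : ∀ k, ∀ᵐ x ∂μ, X k x ∈ Set.Icc (0 : ℝ) 1) :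
    0 ≤ ∑ k, μ[X k] :=
  Finset.sum_nonneg fun k _ => integral_nonneg_of_ae <| (h01 k).mono fun _ hx => hx.1

theorem measureReal_one_add_mul_le_sum_le (hX : ∀ k, AEMeasurable (X k) μ)
    (h01 : ∀ k, ∀ᵐ x ∂μ, X k x ∈ Set.Icc (0 : ℝ) 1) (hind : iIndepFun X μ) {η : ℝ}
    (h0 : 0 ≤ η) (h1 : η ≤ 1) :
    μ.real {x | (1 + η) * ∑ k, μ[X k] ≤ (∑ k, X k) x} ≤
      Real.exp (-(η ^ 2 / 3 * ∑ k, μ[X k])) := by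
  have := hind.isProbabilityMeasure
  have hpos : 0 < 1 + η := by linarith
  set m := ∑ k, μ[X k]
  calc _ ≤ Real.exp (-Real.log (1 + η) * ((1 + η) * m)) * mgf (∑ k, X k) μ (Real.log (1 + η)) :=
        measure_ge_le_exp_mul_mgf _ (Real.log_nonneg (by linarith))
          (integrable_exp_mul_sum_of_mem_Icc hX h01 _)
    _ ≤ Real.exp (-Real.log (1 + η) * ((1 + η) * m)) * Real.exp (η * m) := by
        gcongr
        simpa [Real.exp_log hpos] using
          mgf_sum_le_exp_mul_sum_integral hX h01 hind (Real.log (1 + η))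
    _ = Real.exp ((η - (1 + η) * Real.log (1 + η)) * m) := by rw [← Real.exp_add]; ring_nf
    _ ≤ _ := by
        rw [← neg_mul]
        gcongr
        exacts [sum_integral_nonneg h01, sub_mul_log_one_add_le h0 h1]

theorem measureReal_sum_le_one_sub_mul_le (hX : ∀ k, AEMeasurable (X k) μ)
    (h01 : ∀ k, ∀ᵐ x ∂μ, X k x ∈ Set.Icc (0 : ℝ) 1) (hind : iIndepFun X μ) {η : ℝ}
    (h0 : 0 ≤ η) :
    μ.real {x | (∑ k, X k) x ≤ (1 - η) * ∑ k, μ[X k]} ≤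
      Real.exp (-(η ^ 2 / 2 * ∑ k, μ[X k])) := by
  have := hind.isProbabilityMeasure
  have hm := sum_integral_nonneg h01
  set m := ∑ k, μ[X k]
  calc _ ≤ Real.exp (-(-η) * ((1 - η) * m)) * mgf (∑ k, X k) μ (-η) :=
        measure_le_le_exp_mul_mgf _ (neg_nonpos.2 h0) (integrable_exp_mul_sum_of_mem_Icc hX h01 _)
    _ ≤ Real.exp (-(-η) * ((1 - η) * m)) * Real.exp ((Real.exp (-η) - 1) * m) := by
        gcongr
        exact mgf_sum_le_exp_mul_sum_integral hX h01 hind (-η)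
    _ ≤ Real.exp (-(-η) * ((1 - η) * m)) * Real.exp ((1 - η + η ^ 2 / 2 - 1) * m) := by
        gcongr
        exact exp_neg_le_quadratic h0
    _ = _ := by rw [← Real.exp_add]; ring_nf

theorem measureReal_mul_le_abs_sum_sub_le (hX : ∀ k, AEMeasurable (X k) μ)
    (h01 : ∀ k, ∀ᵐ x ∂μ, X k x ∈ Set.Icc (0 : ℝ) 1) (hind : iIndepFun X μ) {η : ℝ}
    (h0 : 0 ≤ η) (h1 : η ≤ 1) :
    μ.real {x | η * ∑ k, μ[X k] ≤ |∑ k, X k x - ∑ k, μ[X k]|} ≤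
      2 * Real.exp (-(η ^ 2 / 3 * ∑ k, μ[X k])) := by
  have := hind.isProbabilityMeasure
  have hm := sum_integral_nonneg h01
  have hup := measureReal_one_add_mul_le_sum_le hX h01 hind h0 h1
  have hlo := measureReal_sum_le_one_sub_mul_le hX h01 hind h0
  set m := ∑ k, μ[X k]
  calc _ ≤ μ.real ({x | (1 + η) * m ≤ (∑ k, X k) x} ∪ {x | (∑ k, X k) x ≤ (1 - η) * m}) := by
        refine measureReal_mono fun x hx => ?_
        simp only [Set.mem_ofPred_eq, Set.mem_union, Finset.sum_apply] at hx ⊢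
        rcases le_abs'.1 hx with h | h
        · right; linarith
        · left; linarith
    _ ≤ Real.exp (-(η ^ 2 / 3 * m)) + Real.exp (-(η ^ 2 / 2 * m)) :=
        (measureReal_union_le _ _).trans (add_le_add hup hlo)
    _ ≤ Real.exp (-(η ^ 2 / 3 * m)) + Real.exp (-(η ^ 2 / 3 * m)) := by gcongr; norm_num
    _ = _ := (two_mul _).symm

end Chernoff

section NeumannSums

variable {ι : Type*} [Fintype ι] [DecidableEq ι]

lemma geom_sum_succ_mulVec {R : Type*} [Semiring R] (A : Matrix ι ι R) (b : ι → R) (m : ℕ) :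
    (∑ k ∈ Finset.range (m + 1), A ^ k) *ᵥ b =
      A *ᵥ ((∑ k ∈ Finset.range m, A ^ k) *ᵥ b) + b := by
  rw [geom_sum_succ, add_mulVec, one_mulVec, mulVec_mulVec]

lemma le_geom_sum_succ_mulVec {R : Type*} [Semiring R] [PartialOrder R] [IsOrderedRing R]
    {A : Matrix ι ι R} {b : ι → R} (hA : ∀ i j, 0 ≤ A i j) (hb : 0 ≤ b) (m : ℕ) :
    b ≤ (∑ k ∈ Finset.range (m + 1), A ^ k) *ᵥ b := by
  rw [Finset.sum_range_succ', pow_zero, add_mulVec, one_mulVec]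
  have hsum : ∀ i j, 0 ≤ (∑ k ∈ Finset.range m, A ^ (k + 1)) i j := fun i j => by
    rw [Matrix.sum_apply]
    exact Finset.sum_nonneg fun k _ => pow_apply_nonneg hA (k + 1) i j
  exact le_add_of_nonneg_left fun i =>
    Finset.sum_nonneg fun j _ => mul_nonneg (hsum i j) (hb j)

lemma sub_geom_sum_mulVec_eq_pow_mulVec {R : Type*} [Ring R] {A : Matrix ι ι R} {v b : ι → R}
    (hv : v = A *ᵥ v + b) (m : ℕ) :
    v - (∑ k ∈ Finset.range m, A ^ k) *ᵥ b = A ^ m *ᵥ v := by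
  have hb : b = (1 - A) *ᵥ v := by
    rw [sub_mulVec, one_mulVec]
    exact eq_sub_of_add_eq' hv.symm
  conv_lhs => rw [hb]
  rw [mulVec_mulVec, geom_sum_mul_neg, sub_mulVec, one_mulVec, sub_sub_cancel]

open scoped Matrix.Norms.Operator

variable {R : Type*} [NormedRing R] {A : Matrix ι ι R} {c : ℝ}

lemma norm_pow_mulVec_le (hA : ‖A‖ ≤ c) (m : ℕ) (v : ι → R) :
    ‖A ^ m *ᵥ v‖ ≤ c ^ m * ‖v‖ := by
  have hc : 0 ≤ c := (norm_nonneg A).trans hA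
  induction m with
  | zero => simp
  | succ m ih =>
    calc ‖A ^ (m + 1) *ᵥ v‖ = ‖A *ᵥ (A ^ m *ᵥ v)‖ := by rw [pow_succ', mulVec_mulVec]
      _ ≤ ‖A‖ * ‖A ^ m *ᵥ v‖ := linfty_opNorm_mulVec _ _
      _ ≤ c * (c ^ m * ‖v‖) := by gcongr
      _ = c ^ (m + 1) * ‖v‖ := by ring

lemma norm_le_div_of_eq_mulVec_add (hA : ‖A‖ ≤ c) (hc : c < 1) {v b : ι → R}
    (hv : v = A *ᵥ v + b) : ‖v‖ ≤ ‖b‖ / (1 - c) := by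
  rw [le_div_iff₀ (sub_pos.2 hc)]
  have h : ‖v‖ ≤ c * ‖v‖ + ‖b‖ :=
    calc ‖v‖ = ‖A *ᵥ v + b‖ := congrArg _ hv
      _ ≤ ‖A *ᵥ v‖ + ‖b‖ := norm_add_le _ _
      _ ≤ ‖A‖ * ‖v‖ + ‖b‖ := by gcongr; exact linfty_opNorm_mulVec A v
      _ ≤ c * ‖v‖ + ‖b‖ := by gcongr
  linarith

theorem norm_sub_geom_sum_mulVec_le (hA : ‖A‖ ≤ c) (hc : c < 1) {v b : ι → R}
    (hv : v = A *ᵥ v + b) (m : ℕ) :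
    ‖v - (∑ k ∈ Finset.range m, A ^ k) *ᵥ b‖ ≤ c ^ m * (‖b‖ / (1 - c)) := by
  have hc0 : 0 ≤ c := (norm_nonneg A).trans hA
  rw [sub_geom_sum_mulVec_eq_pow_mulVec hv]
  refine (norm_pow_mulVec_le hA m v).trans ?_
  gcongr
  exact norm_le_div_of_eq_mulVec_add hA hc hv

end NeumannSums

section FriedkinJohnsen

open scoped Matrix.Norms.Operator

lemma one_sub_diagonal {ι R : Type*} [DecidableEq ι] [AddGroupWithOne R] (d : ι → R) :
    1 - diagonal d = diagonal (1 - d) := by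
  rw [← diagonal_one, diagonal_sub]
  rfl

variable {ι : Type*} [Fintype ι] [DecidableEq ι] {W : Matrix ι ι ℝ} {stub : ι → ℝ} {θ : ℝ}

lemma linfty_opNorm_le_one_of_mem_rowStochastic (hW : W ∈ rowStochastic ℝ ι) : ‖W‖ ≤ 1 := by
  rw [linfty_opNorm_def, NNReal.coe_le_one]
  refine Finset.sup_le fun i _ => NNReal.coe_le_one.1 (le_of_eq ?_)
  rw [NNReal.coe_sum, ← sum_row_of_mem_rowStochastic hW i]
  exact Finset.sum_congr rfl fun j _ => Real.norm_of_nonneg (hW.1 i j)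

lemma linfty_opNorm_one_sub_diagonal_le (hθ1 : θ ≤ 1) (hstub : ∀ i, stub i ∈ Set.Icc θ 1) :
    ‖1 - diagonal stub‖ ≤ 1 - θ := by
  rw [one_sub_diagonal, linfty_opNorm_diagonal]
  refine (pi_norm_le_iff_of_nonneg (sub_nonneg.2 hθ1)).2 fun i => ?_
  rw [Pi.sub_apply, Pi.one_apply, Real.norm_of_nonneg (sub_nonneg.2 (hstub i).2)]
  exact sub_le_sub_left (hstub i).1 1

lemma linfty_opNorm_one_sub_diagonal_mul_le (hW : W ∈ rowStochastic ℝ ι) (hθ1 : θ ≤ 1)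
    (hstub : ∀ i, stub i ∈ Set.Icc θ 1) : ‖(1 - diagonal stub) * W‖ ≤ 1 - θ :=
  calc ‖(1 - diagonal stub) * W‖ ≤ ‖1 - diagonal stub‖ * ‖W‖ := norm_mul_le _ _
    _ ≤ (1 - θ) * 1 := by
        gcongr
        exacts [linfty_opNorm_one_sub_diagonal_le hθ1 hstub,
          linfty_opNorm_le_one_of_mem_rowStochastic hW]
    _ = 1 - θ := mul_one _

theorem solution_eq (hW : W ∈ rowStochastic ℝ ι) (hθ : 0 < θ) (hθ1 : θ ≤ 1)
    (hstub : ∀ i, stub i ∈ Set.Icc θ 1) :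
    solution W stub = (1 - diagonal stub) * W * solution W stub + diagonal stub := by
  have hunit : IsUnit (1 - (1 - diagonal stub) * W) := isUnit_one_sub_of_norm_lt_one <|
    (linfty_opNorm_one_sub_diagonal_mul_le hW hθ1 hstub).trans_lt (by linarith)
  have hmul : (1 - (1 - diagonal stub) * W) * solution W stub = diagonal stub := by
    rw [solution, ← mul_assoc, mul_nonsing_inv _ ((isUnit_iff_isUnit_det _).1 hunit), one_mul]
  rw [sub_mul, one_mul] at hmul
  exact eq_add_of_sub_eq' hmul

end FriedkinJohnsen

section SocialPower

open scoped Matrix.Norms.Operator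

variable {n : ℕ} {W : Matrix (Fin n) (Fin n) ℝ} {stub : Fin n → ℝ} {ω θ : ℝ}
  {S : Finset (Fin n)}

/-- The vector `(I - Θ) ω ∑ j ∈ S, e_j` of the weights with which the agents take up the
influencer's opinion in one step; equivalently, of the one-step absorption probabilities. -/
def exposure (stub : Fin n → ℝ) (ω : ℝ) (S : Finset (Fin n)) : Fin n → ℝ :=
  (1 - diagonal stub) *ᵥ (ω • ind S)

/-- The vector of the weights of the influencer's initial opinion in the agents' final opinions,
that is, the influencer's column of the solution matrix; `sp₀` is its average. -/
noncomputable def influence (W : Matrix (Fin n) (Fin n) ℝ) (stub : Fin n → ℝ) (ω : ℝ)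
    (S : Finset (Fin n)) : Fin n → ℝ :=
  fun i => solution (augWeight W ω S) (augStub stub) (some i) none

lemma ind_mem_Icc (S : Finset (Fin n)) (i : Fin n) : ind S i ∈ Set.Icc (0 : ℝ) 1 := by
  unfold ind; split_ifs <;> simp

lemma mul_ind_mem_Icc (hω : ω ∈ Set.Icc (0 : ℝ) 1) (S : Finset (Fin n)) (i : Fin n) :
    ω * ind S i ∈ Set.Icc (0 : ℝ) 1 :=
  unitInterval.mul_mem hω (ind_mem_Icc S i)

lemma H_apply (i j : Fin n) :
    H W stub ω S i j = (1 - ω * ind S i) * (1 - stub i) * W i j := by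
  rw [H, ← diagonal_smul, one_sub_diagonal, one_sub_diagonal, diagonal_mul_diagonal, diagonal_mul]
  rfl

lemma exposure_apply (i : Fin n) : exposure stub ω S i = ω * (1 - stub i) * ind S i := by
  rw [exposure, one_sub_diagonal, mulVec_diagonal]
  simp only [Pi.sub_apply, Pi.one_apply, Pi.smul_apply, smul_eq_mul]
  ring

lemma H_nonneg (hW : W ∈ rowStochastic ℝ (Fin n)) (hω : ω ∈ Set.Icc (0 : ℝ) 1)
    (hstub : ∀ i, stub i ≤ 1) (i j : Fin n) : 0 ≤ H W stub ω S i j := by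
  rw [H_apply]
  exact mul_nonneg (mul_nonneg (sub_nonneg.2 (mul_ind_mem_Icc hω S i).2)
    (sub_nonneg.2 (hstub i))) (hW.1 i j)

lemma exposure_nonneg (hω : 0 ≤ ω) (hstub : ∀ i, stub i ≤ 1) : 0 ≤ exposure stub ω S := by
  intro i
  rw [exposure_apply]
  exact mul_nonneg (mul_nonneg hω (sub_nonneg.2 (hstub i))) (ind_mem_Icc S i).1

lemma linfty_opNorm_H_le (hW : W ∈ rowStochastic ℝ (Fin n)) (hω : ω ∈ Set.Icc (0 : ℝ) 1)
    (hθ1 : θ ≤ 1) (hstub : ∀ i, stub i ∈ Set.Icc θ 1) : ‖H W stub ω S‖ ≤ 1 - θ := by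
  have hS : ‖1 - ω • diagonal (ind S)‖ ≤ 1 := by
    rw [← diagonal_smul]
    exact (linfty_opNorm_one_sub_diagonal_le (stub := ω • ind S) zero_le_one
      (mul_ind_mem_Icc hω S)).trans_eq (sub_zero 1)
  calc ‖H W stub ω S‖ = ‖(1 - ω • diagonal (ind S)) * ((1 - diagonal stub) * W)‖ := by
        rw [H, mul_assoc]
    _ ≤ ‖1 - ω • diagonal (ind S)‖ * ‖(1 - diagonal stub) * W‖ := norm_mul_le _ _
    _ ≤ 1 * (1 - θ) := by
        gcongr
        exact linfty_opNorm_one_sub_diagonal_mul_le hW hθ1 hstub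
    _ = 1 - θ := one_mul _

lemma norm_exposure_le (hω : 0 ≤ ω) (hθ1 : θ ≤ 1) (hstub : ∀ i, stub i ∈ Set.Icc θ 1) :
    ‖exposure stub ω S‖ ≤ (1 - θ) * ω := by
  have hind : ‖ind S‖ ≤ 1 := (pi_norm_le_iff_of_nonneg zero_le_one).2 fun i => by
    rw [Real.norm_of_nonneg (ind_mem_Icc S i).1]
    exact (ind_mem_Icc S i).2
  calc ‖exposure stub ω S‖ ≤ ‖1 - diagonal stub‖ * ‖ω • ind S‖ := linfty_opNorm_mulVec _ _
    _ = ‖1 - diagonal stub‖ * (ω * ‖ind S‖) := by rw [norm_smul, Real.norm_of_nonneg hω]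
    _ ≤ (1 - θ) * (ω * 1) := by
        gcongr
        exact linfty_opNorm_one_sub_diagonal_le hθ1 hstub
    _ = (1 - θ) * ω := by rw [mul_one]

lemma augWeight_mem_rowStochastic (hW : W ∈ rowStochastic ℝ (Fin n))
    (hω : ω ∈ Set.Icc (0 : ℝ) 1) : augWeight W ω S ∈ rowStochastic ℝ (Option (Fin n)) := by
  refine mem_rowStochastic_iff_sum.2 ⟨?_, ?_⟩
  · rintro (_ | i) (_ | j)
    exacts [zero_le_one, le_rfl, (mul_ind_mem_Icc hω S i).1,
      mul_nonneg (sub_nonneg.2 (mul_ind_mem_Icc hω S i).2) (hW.1 i j)]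
  · rintro (_ | i)
    · simp [Fintype.sum_option, augWeight]
    · simp [Fintype.sum_option, augWeight, ← Finset.mul_sum, sum_row_of_mem_rowStochastic hW]

lemma augStub_mem_Icc (hθ1 : θ ≤ 1) (hstub : ∀ i, stub i ∈ Set.Icc θ 1) :
    ∀ i, augStub stub i ∈ Set.Icc θ 1
  | none => ⟨hθ1, le_rfl⟩
  | some i => hstub i

theorem influence_eq (hW : W ∈ rowStochastic ℝ (Fin n)) (hω : ω ∈ Set.Icc (0 : ℝ) 1)
    (hθ : 0 < θ) (hθ1 : θ ≤ 1) (hstub : ∀ i, stub i ∈ Set.Icc θ 1) :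
    influence W stub ω S = H W stub ω S *ᵥ influence W stub ω S + exposure stub ω S := by
  have hsol := solution_eq (augWeight_mem_rowStochastic (S := S) hW hω) hθ hθ1
    (augStub_mem_Icc hθ1 hstub)
  rw [one_sub_diagonal, mul_assoc] at hsol
  have hnone : solution (augWeight W ω S) (augStub stub) none none = 1 := by
    have h := congrFun (congrFun hsol none) none
    rwa [Matrix.add_apply, diagonal_mul, Pi.sub_apply, Pi.one_apply, augStub, sub_self, zero_mul,
      zero_add, diagonal_apply_eq] at h
  funext i
  have h := congrFun (congrFun hsol (some i)) none
  rw [Matrix.add_apply, diagonal_mul, diagonal_apply_ne _ (Option.some_ne_none i), add_zero,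
    mul_apply, Fintype.sum_option, hnone] at h
  refine h.trans ?_
  simp only [Pi.add_apply, Pi.sub_apply, Pi.one_apply, mulVec, dotProduct, H_apply, exposure_apply,
    augStub, augWeight, influence, mul_add, Finset.mul_sum]
  rw [add_comm]
  congr 1
  · exact Finset.sum_congr rfl fun j _ => by ring
  · ring

lemma abs_average_le_norm (u : Fin n → ℝ) : |1 / (n : ℝ) * ∑ i, u i| ≤ ‖u‖ := by
  rw [abs_mul, abs_of_nonneg (by positivity), one_div, ← div_eq_inv_mul]
  refine div_le_of_le_mul₀ n.cast_nonneg (norm_nonneg u) ?_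
  calc |∑ i, u i| ≤ ∑ i, |u i| := Finset.abs_sum_le_sum_abs _ _
    _ ≤ ∑ _i : Fin n, ‖u‖ := Finset.sum_le_sum fun i _ => norm_le_pi_norm u i
    _ = ‖u‖ * n := by simp [mul_comm]

theorem abs_spTrunc_sub_sp₀_le (hW : W ∈ rowStochastic ℝ (Fin n)) (hω : ω ∈ Set.Icc (0 : ℝ) 1)
    (hθ : 0 < θ) (hθ1 : θ ≤ 1) (hstub : ∀ i, stub i ∈ Set.Icc θ 1) (ℓ : ℕ) :
    |spTrunc W stub ω S ℓ - sp₀ W stub ω S| ≤ ω * (1 - θ) ^ (ℓ + 2) / θ := by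
  rw [abs_sub_comm, sp₀, spTrunc, ← mul_sub, ← Finset.sum_sub_distrib]
  calc _ ≤ ‖influence W stub ω S -
          (∑ k ∈ Finset.range (ℓ + 1), H W stub ω S ^ k) *ᵥ exposure stub ω S‖ :=
        abs_average_le_norm _
    _ ≤ (1 - θ) ^ (ℓ + 1) * (‖exposure stub ω S‖ / (1 - (1 - θ))) :=
        norm_sub_geom_sum_mulVec_le (linfty_opNorm_H_le hW hω hθ1 hstub) (by linarith)
          (influence_eq hW hω hθ hθ1 hstub) (ℓ + 1)
    _ ≤ (1 - θ) ^ (ℓ + 1) * ((1 - θ) * ω / θ) := by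
        rw [sub_sub_cancel]
        refine mul_le_mul_of_nonneg_left ?_ (pow_nonneg (sub_nonneg.2 hθ1) _)
        gcongr
        exact norm_exposure_le hω.1 hθ1 hstub
    _ = _ := by ring

theorem spTrunc_pos (hW : W ∈ rowStochastic ℝ (Fin n)) (hω : ω ∈ Set.Ioc (0 : ℝ) 1)
    (hstub : ∀ i, stub i ≤ 1) (hS : ∃ i ∈ S, stub i < 1) (ℓ : ℕ) :
    0 < spTrunc W stub ω S ℓ := by
  obtain ⟨a, haS, ha⟩ := hS
  have hn : (0 : ℝ) < n := by exact_mod_cast a.pos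
  have hnonneg : 0 ≤ exposure stub ω S := exposure_nonneg hω.1.le hstub
  have hpos : 0 < exposure stub ω S a := by
    rw [exposure_apply, ind, if_pos haS, mul_one]
    exact mul_pos hω.1 (sub_pos.2 ha)
  have hle := le_geom_sum_succ_mulVec (H_nonneg (S := S) hW ⟨hω.1.le, hω.2⟩ hstub) hnonneg ℓ
  exact mul_pos (by positivity) (Finset.sum_pos' (fun i _ => (hnonneg i).trans (hle i))
    ⟨a, Finset.mem_univ a, hpos.trans_le (hle a)⟩)

end SocialPower

section Paths

variable {α R : Type*} [CommSemiring R] {m : ℕ}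

/-- The weight of the path `y 0, …, y m` under the initial weights `f` and the transition matrix
`T`, the probability of that trajectory when `f` is a distribution and `T` is stochastic. -/
def pathWeight (T : Matrix α α R) (f : α → R) (y : Fin (m + 1) → α) : R :=
  f (y 0) * ∏ t : Fin m, T (y t.castSucc) (y t.succ)

lemma pathWeight_cons (T : Matrix α α R) (f : α → R) (a : α) (y : Fin (m + 1) → α) :
    pathWeight T f (Fin.cons a y : Fin (m + 2) → α) =
      f a * T a (y 0) * ∏ t : Fin m, T (y t.castSucc) (y t.succ) := by
  simp only [pathWeight, Fin.prod_univ_succ, Fin.cons_zero, Fin.castSucc_zero, Fin.cons_succ,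
    ← Fin.succ_castSucc, mul_assoc]

lemma last_eq_of_pathWeight_ne_zero {T : Matrix α α R} {f : α → R} {a : α}
    (ha : ∀ b ≠ a, T a b = 0) {y : Fin (m + 1) → α} (hy : pathWeight T f y ≠ 0)
    (hvisit : ∃ t, y t = a) : y (Fin.last m) = a := by
  obtain ⟨t, ht⟩ := hvisit
  have hstep : ∀ s : Fin m, y s.castSucc = a → y s.succ = a := by
    intro s hs
    by_contra hne
    refine hy (mul_eq_zero_of_right _ (Finset.prod_eq_zero (Finset.mem_univ s) ?_))
    rw [hs, ha _ hne]
  have hstay : ∀ s, t ≤ s → y s = a := by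
    intro s
    induction s using Fin.induction with
    | zero => intro h; rwa [← Fin.le_zero_iff.1 h]
    | succ s ih =>
      intro h
      rcases h.eq_or_lt with h | h
      · rwa [← h]
      · exact hstep s (ih (Fin.le_castSucc_iff.2 h))
  exact hstay _ (Fin.le_last t)

variable [Fintype α] [DecidableEq α]

lemma sum_pathWeight_last_eq (T : Matrix α α R) (f : α → R) (a : α) :
    ∑ y : Fin (m + 1) → α with y (Fin.last m) = a, pathWeight T f y = (f ᵥ* T ^ m) a := by
  rw [Finset.sum_filter]
  induction m generalizing f with
  | zero =>
    rw [← (Equiv.funUnique (Fin 1) α).symm.sum_comp]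
    simp [Equiv.funUnique, uniqueElim, pathWeight]
  | succ m ih =>
    rw [pow_succ', ← vecMul_vecMul, ← ih, ← (Fin.consEquiv fun _ => α).sum_comp,
      Fintype.sum_prod_type, Finset.sum_comm]
    refine Finset.sum_congr rfl fun y _ => ?_
    simp only [Fin.consEquiv, Equiv.coe_fn_mk, ← Fin.succ_last, Fin.cons_succ, pathWeight_cons]
    split_ifs
    · rw [← Finset.sum_mul]
      rfl
    · exact Finset.sum_const_zero

theorem sum_pathWeight_exists_eq {T : Matrix α α R} {a : α} (ha : ∀ b ≠ a, T a b = 0)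
    (f : α → R) :
    ∑ y : Fin (m + 1) → α with ∃ t, y t = a, pathWeight T f y = (f ᵥ* T ^ m) a := by
  rw [← sum_pathWeight_last_eq]
  refine (Finset.sum_subset (Finset.monotone_filter_right _ fun y _ h => ⟨_, h⟩)
    fun y hy hlast => ?_).symm
  simp only [Finset.mem_filter, Finset.mem_univ, true_and] at hy hlast
  by_contra hne
  exact hlast (last_eq_of_pathWeight_ne_zero ha hne hy)

end Paths

section Absorption

variable {n : ℕ} {W : Matrix (Fin n) (Fin n) ℝ} {stub : Fin n → ℝ} {ω : ℝ}
  {S : Finset (Fin n)}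

lemma sum_state (f : State n → ℝ) :
    ∑ s, f s = f .influencer + ∑ i, f (.agent i) + ∑ i, f (.anchor i) := by
  let e : Unit ⊕ Fin n ⊕ Fin n ≃ State n :=
    { toFun := Sum.elim (fun _ => .influencer) (Sum.elim .agent .anchor)
      invFun := fun s => match s with
        | .influencer => .inl ()
        | .agent i => .inr (.inl i)
        | .anchor i => .inr (.inr i)
      left_inv := by rintro (_ | _ | _) <;> rfl
      right_inv := by rintro (_ | _ | _) <;> rfl }
  rw [← e.sum_comp]
  simp [e, add_assoc]

/-- The function on states that is `1` at the influencer, `v` at the agents and `0` at the anchors: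
the shape of the probabilities of being absorbed by the influencer within a number of steps. -/
def absorptionProfile (v : Fin n → ℝ) : State n → ℝ
  | .influencer => 1
  | .agent i => v i
  | .anchor _ => 0

lemma trans_mulVec_absorptionProfile (v : Fin n → ℝ) :
    trans W stub ω S *ᵥ absorptionProfile v =
      absorptionProfile (H W stub ω S *ᵥ v + exposure stub ω S) := by
  funext s
  rw [mulVec, dotProduct, sum_state]
  cases s <;> simp [trans, absorptionProfile, exposure_apply, mulVec, dotProduct, add_comm]

lemma trans_pow_mulVec_absorptionProfile_zero (m : ℕ) :
    trans W stub ω S ^ m *ᵥ absorptionProfile 0 =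
      absorptionProfile ((∑ k ∈ Finset.range m, H W stub ω S ^ k) *ᵥ exposure stub ω S) := by
  induction m with
  | zero => simp
  | succ m ih =>
    rw [pow_succ', ← mulVec_mulVec, ih, trans_mulVec_absorptionProfile, geom_sum_succ_mulVec]

theorem start_vecMul_trans_pow_influencer (ℓ : ℕ) :
    (start ᵥ* trans W stub ω S ^ (ℓ + 1)) .influencer = spTrunc W stub ω S ℓ := by
  have hzero : absorptionProfile 0 = (Pi.single .influencer 1 : State n → ℝ) := by
    funext s
    cases s <;> simp [absorptionProfile]
  calc (start ᵥ* trans W stub ω S ^ (ℓ + 1)) .influencer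
      = start ⬝ᵥ (trans W stub ω S ^ (ℓ + 1) *ᵥ absorptionProfile 0) := by
        rw [hzero, mulVec_single_one]
        rfl
    _ = spTrunc W stub ω S ℓ := by
        rw [trans_pow_mulVec_absorptionProfile_zero, dotProduct, sum_state]
        simp [start, absorptionProfile, spTrunc, exposure, Finset.mul_sum]

theorem IsWalk.measureReal_exists_eq_influencer {Ω : Type*} [MeasurableSpace Ω] {μ : Measure Ω}
    [IsFiniteMeasure μ] {ℓ : ℕ} {Y : Ω → Fin (ℓ + 1 + 1) → State n}
    (hY : IsWalk μ W stub ω S Y) :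
    μ.real {x | ∃ t, Y x t = .influencer} = spTrunc W stub ω S ℓ := by
  have habs : ∀ b ≠ .influencer, trans W stub ω S .influencer b = 0 := by
    rintro (_ | _ | _) hb
    exacts [absurd rfl hb, rfl, rfl]
  calc μ.real {x | ∃ t, Y x t = .influencer}
      = ∑ y : Fin (ℓ + 1 + 1) → State n with ∃ t, y t = .influencer, μ.real (Y ⁻¹' {y}) := by
        rw [sum_measureReal_preimage_singleton _ fun y _ =>
          hY.measurable (measurableSet_singleton y)]
        congr 1
        ext x
        simp
    _ = ∑ y : Fin (ℓ + 1 + 1) → State n with ∃ t, y t = .influencer,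
          pathWeight (trans W stub ω S) start y := Finset.sum_congr rfl fun y _ => hY.law y
    _ = spTrunc W stub ω S ℓ := by
        rw [sum_pathWeight_exists_eq habs, start_vecMul_trans_pow_influencer]

end Absorption

section MonteCarlo

variable {n : ℕ} {W : Matrix (Fin n) (Fin n) ℝ} {stub : Fin n → ℝ} {ω : ℝ}
  {S : Finset (Fin n)}

lemma mul_spApx {r m : ℕ} (w : Fin r → Fin (m + 1) → State n) :
    r * spApx w = ∑ k, Set.indicator {y | ∃ t, y t = State.influencer} 1 (w k) := by
  classical
  rw [spApx, mul_div_cancel_of_imp']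
  · simp [Set.indicator_apply]
  · intro hr
    obtain rfl : r = 0 := by exact_mod_cast hr
    simp

theorem measureReal_mul_spTrunc_le_abs_spApx_sub_le {Ω : Type*} [MeasurableSpace Ω]
    {μ : Measure Ω} {r ℓ : ℕ} {Y : Fin r → Ω → Fin (ℓ + 1 + 1) → State n}
    (hY : ∀ k, IsWalk μ W stub ω S (Y k)) (hindep : iIndepFun Y μ) {η : ℝ} (h0 : 0 ≤ η)
    (h1 : η ≤ 1) :
    μ.real {x | η * spTrunc W stub ω S ℓ ≤
        |spApx (fun k => Y k x) - spTrunc W stub ω S ℓ|} ≤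
      2 * Real.exp (-(η ^ 2 / 3 * (r * spTrunc W stub ω S ℓ))) := by
  have := hindep.isProbabilityMeasure
  set p := spTrunc W stub ω S ℓ
  let A : Set (Fin (ℓ + 1 + 1) → State n) := {y | ∃ t, y t = .influencer}
  let X : Fin r → Ω → ℝ := fun k => A.indicator 1 ∘ Y k
  have hX : ∀ k, Measurable (X k) := fun k => (measurable_of_finite _).comp (hY k).measurable
  have h01 : ∀ k x, X k x ∈ Set.Icc (0 : ℝ) 1 := fun k x =>
    ⟨Set.indicator_nonneg (fun _ _ => zero_le_one) _,
      Set.indicator_le_self' (fun _ _ => zero_le_one) _⟩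
  have hmean : ∑ k, μ[X k] = r * p := by
    have h : ∀ k, μ[X k] = p := fun k =>
      (integral_indicator_one ((hY k).measurable A.toFinite.measurableSet)).trans
        (hY k).measureReal_exists_eq_influencer
    simp [h]
  have hchernoff := measureReal_mul_le_abs_sum_sub_le (fun k => (hX k).aemeasurable)
    (fun k => .of_forall (h01 k)) (hindep.comp _ fun _ => measurable_of_finite _) h0 h1
  rw [hmean] at hchernoff
  refine (measureReal_mono fun x hx => ?_).trans hchernoff
  have hsum : ∑ k, X k x = r * spApx fun k => Y k x := (mul_spApx _).symm
  rw [Set.mem_ofPred_eq] at hx ⊢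
  rw [hsum, ← mul_sub, abs_mul, Nat.abs_cast, mul_left_comm]
  exact mul_le_mul_of_nonneg_left hx r.cast_nonneg

end MonteCarlo

section Parameters

lemma mul_pow_le_of_log_sub_div_log_le {b q x : ℝ} {m : ℕ} (hb : 0 < b) (hq : q ∈ Set.Ioo 0 1)
    (hx : 0 < x) (hm : (Real.log x - Real.log b) / Real.log q ≤ m) : b * q ^ m ≤ x := by
  have hlog : m * Real.log q ≤ Real.log x - Real.log b :=
    (div_le_iff_of_neg (Real.log_neg hq.1 hq.2)).1 hm
  have hpow : 0 < q ^ m := pow_pos hq.1 m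
  rw [← Real.log_le_log_iff (mul_pos hb hpow) hx, Real.log_mul hb.ne' hpow.ne', Real.log_pow]
  linarith

lemma mul_exp_neg_le_of_log_div_le {K δ x : ℝ} (hK : 0 < K) (hδ : 0 < δ)
    (hx : Real.log (K / δ) ≤ x) : K * Real.exp (-x) ≤ δ := by
  have h : K / δ ≤ Real.exp x := (Real.log_le_iff_le_exp (div_pos hK hδ)).1 hx
  rwa [Real.exp_neg, ← div_eq_mul_inv, div_le_comm₀ (Real.exp_pos x) hδ]

lemma one_sub_le_measureReal_of_compl_subset {Ω : Type*} [MeasurableSpace Ω] {μ : Measure Ω}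
    [IsProbabilityMeasure μ] {A B : Set Ω} {δ : ℝ} (hB : μ.real B ≤ δ) (hBA : Bᶜ ⊆ A) :
    1 - δ ≤ μ.real A := by
  have hcover : μ.real Set.univ ≤ μ.real A + μ.real B :=
    (measureReal_mono (by rw [← Set.compl_subset_iff_union.1 hBA, Set.union_comm])).trans
      (measureReal_union_le A B)
  rw [probReal_univ] at hcover
  linarith

end Parameters

end FJ

theorem theorem2_general {n : ℕ} (W : Matrix (Fin n) (Fin n) ℝ) (stub : Fin n → ℝ)
    (ω θ ε δ σ : ℝ) (S : Finset (Fin n)) (r ℓ : ℕ)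
    (hW : W ∈ Matrix.rowStochastic ℝ (Fin n)) (hω : ω ∈ Set.Ioc (0 : ℝ) 1)
    (hθ : 0 < θ) (hstub : ∀ i, stub i ∈ Set.Icc θ 1) (hS : ∃ i ∈ S, stub i < 1)
    (hε : 0 < ε) (hδ : 0 < δ) (hσ : σ ∈ Set.Ioo (0 : ℝ) 1) (hσε : σ * ε ≤ 1)
    (hr : (r : ℝ) ≥ 3 / (σ ^ 2 * ε ^ 2 * FJ.spTrunc W stub ω S ℓ) * Real.log (2 / δ))
    (hℓ : (ℓ : ℝ) ≥
      (Real.log (θ * (1 - σ) * ε * FJ.spTrunc W stub ω S ℓ) - Real.log ω) / Real.log (1 - θ) - 2)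
    {Ω : Type*} [MeasurableSpace Ω] (μ : Measure Ω)
    (Y : Fin r → Ω → Fin (ℓ + 1 + 1) → FJ.State n)
    (hY : ∀ k, FJ.IsWalk μ W stub ω S (Y k)) (hindep : iIndepFun Y μ) :
    μ.real {x | |FJ.spApx (fun k => Y k x) - FJ.sp₀ W stub ω S| < ε * FJ.spTrunc W stub ω S ℓ} ≥
      1 - δ := by
  have := hindep.isProbabilityMeasure
  have hθ1 : θ < 1 := hS.elim fun i hi => (hstub i).1.trans_lt hi.2
  have hp := FJ.spTrunc_pos hW hω (fun i => (hstub i).2) hS ℓ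
  have hbias := FJ.abs_spTrunc_sub_sp₀_le (S := S) hW ⟨hω.1.le, hω.2⟩ hθ hθ1.le hstub ℓ
  have hη : 0 < σ * ε := mul_pos hσ.1 hε
  have hdev := FJ.measureReal_mul_spTrunc_le_abs_spApx_sub_le hY hindep hη.le hσε
  set p := FJ.spTrunc W stub ω S ℓ
  have hσ1 : 0 < 1 - σ := sub_pos.2 hσ.2
  have htrunc : ω * (1 - θ) ^ (ℓ + 2) / θ ≤ (1 - σ) * ε * p := by
    have h := FJ.mul_pow_le_of_log_sub_div_log_le (m := ℓ + 2) hω.1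
      ⟨sub_pos.2 hθ1, sub_lt_self 1 hθ⟩ (by positivity : 0 < θ * (1 - σ) * ε * p)
      (by push_cast; linarith)
    rw [div_le_iff₀' hθ]
    linarith
  have hfail : 2 * Real.exp (-((σ * ε) ^ 2 / 3 * (r * p))) ≤ δ := by
    refine FJ.mul_exp_neg_le_of_log_div_le two_pos hδ ?_
    rw [ge_iff_le, ← mul_pow, div_mul_eq_mul_div, div_le_iff₀ (by positivity)] at hr
    linarith
  refine FJ.one_sub_le_measureReal_of_compl_subset (hdev.trans hfail) fun x hx => ?_
  simp only [Set.mem_compl_iff, Set.mem_ofPred_eq, not_le] at hx ⊢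
  linarith [abs_sub_le (FJ.spApx fun k => Y k x) p (FJ.sp₀ W stub ω S)]

theorem theorem2 {n : ℕ} (W : Matrix (Fin n) (Fin n) ℝ) (stub : Fin n → ℝ) (ω θ ε δ σ : ℝ)
    (S : Finset (Fin n)) (r ℓ : ℕ)
    (hW : W ∈ Matrix.rowStochastic ℝ (Fin n)) (hconn : FJ.StronglyConnected W)
    (hω : ω ∈ Set.Ioo (0 : ℝ) 1)
    (hθ : 0 < θ) (hstub : ∀ i, stub i ∈ Set.Icc θ 1)
    (hS : ∃ i ∈ S, stub i < 1)
    (hε : ε ∈ Set.Ioo (0 : ℝ) 1) (hδ : δ ∈ Set.Ioo (0 : ℝ) 1) (hσ : σ ∈ Set.Ioo (0 : ℝ) 1)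
    (hr : (r : ℝ) ≥ 3 / (σ ^ 2 * ε ^ 2 * FJ.spTrunc W stub ω S ℓ) * Real.log (2 / δ))
    (hℓ : (ℓ : ℝ) ≥
      (Real.log (θ * (1 - σ) * ε * FJ.spTrunc W stub ω S ℓ) - Real.log ω) / Real.log (1 - θ) - 2)
    {Ω : Type*} [MeasurableSpace Ω] (μ : MeasureTheory.Measure Ω)
    [MeasureTheory.IsProbabilityMeasure μ]
    -- `r` independent walks, each with `ℓ` steps before the last one, which may be absorbing
    (Y : Fin r → Ω → Fin (ℓ + 1 + 1) → FJ.State n)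
    (hY : ∀ k, FJ.IsWalk μ W stub ω S (Y k)) (hindep : ProbabilityTheory.iIndepFun Y μ) :
    μ.real {x | |FJ.spApx (fun k => Y k x) - FJ.sp₀ W stub ω S| < ε * FJ.spTrunc W stub ω S ℓ} ≥
      1 - δ := by
  exact theorem2_general W stub ω θ ε δ σ S r ℓ hW ⟨hω.1, hω.2.le⟩ hθ hstub hS hε.1 hδ.1 hσ
    (mul_le_one₀ hσ.2.le hε.1.le hε.2.le) hr hℓ μ Y hY hindep
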